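/- Let $\mathbb H=\mathbb R^3$ be the Heisenberg group, with the group law $(x,y,z)\cdot(x',y',z')=(x+x',\,y+y',\,z+z'+\tfrac12(xy'-x'y))$ and the left-invariant vector fields $X=\partial_x-\frac y2\partial_z$ and $Y=\partial_y+\frac x2\partial_z$. Its sub-Lorentzian metric, on the distribution spanned by $X$ and $Y$, is $\langle u_1X+u_2Y,\,v_1X+v_2Y\rangle=u_2v_2-u_1v_1$, and $X$ is the time orientation. A horizontal curve is an absolutely continuous curve $\gamma:[a,b]\to\mathbb H$, $a<b$, such that $\dot\gamma(t)=u_1(t)X(\gamma(t))+u_2(t)Y(\gamma(t))$ for almost every $t$, for some control $u=(u_1,u_2)\in L^\infty([a,b],\mathbb R^2)$. It is future-directed causal if, for almost every $t$, $u(t)\ne0$, $u_2(t)^2-u_1(t)^2\le0$ and $u_1(t)>0$; past-directed causal if the same holds with $u_1(t)<0$ in place of $u_1(t)>0$; and future-directed timelike if $u_2(t)^2-u_1(t)^2<0$ and $u_1(t)>0$ for almost every $t$. A causal curve is a curve that is either future-directed causal or past-directed causal. Write $p\ll q$ if a future-directed timelike curve joins $p$ to $q$, and $p\le q$ if $p=q$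 or a future-directed causal curve joins $p$ to $q$. For $A\subseteq\mathbb H$ put $J^+(A)=\{q:\exists p\in A,\ p\le q\}$, $J^-(A)=\{p:\exists q\in A,\ p\le q\}$, and define $I^\pm(A)$ in the same way with $\ll$; write $J^\pm(p)=J^\pm(\{p\})$ and $I^\pm(p)=I^\pm(\{p\})$. The sub-Riemannian length of a horizontal curve is $L_{\mathrm{sR}}(\gamma)=\int_a^b\sqrt{u_1^2+u_2^2}\,dt$, the sub-Riemannian distance $d(p,q)$ is the infimum of the sub-Riemannian lengths of the horizontal curves that join $p$ to $q$, and $L_d(\gamma)$ is the length of $\gamma$ with respect to $d$, i.e. the supremum of $\sum_i d(\gamma(t_i),\gamma(t_{i+1}))$ over all finite partitions of $[a,b]$. All topological notions on $\mathbb H$ are with respect to $d$. Then the sub-Lorentzian Heisenberg group is 1. strongly causal: the topology generated by the subbase $\{I^+(p)\cap I^-(q): p,q\in\mathbb H\}$ coincides with the metric topology of $d$; 2. causally closed: $\{(p,q)\in\mathbb H^2: p\le q\}$ is closed in the product topology; 3. compatible with $d$: every $q\in\mathbb H$ has a neighbourhood $\mathcal U$ for which there is a constant $C>0$ such that $L_d(\gamma)\le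 C$ for all causal curves $\gamma$ with values in $\mathcal U$; 4. non-totally imprisoning: for every compact $K\subseteq\mathbb H$ there is a constant $C>0$ such that $L_{\mathrm{sR}}(\gamma)\le C$ for all causal curves $\gamma$ with values in $K$; 5. globally hyperbolic: it is non-totally imprisoning and $J^+(p)\cap J^-(q)$ is compact for all $p,q\in\mathbb H$; 6. $\mathcal K$-globally hyperbolic: it is non-totally imprisoning and $J^+(K_1)\cap J^-(K_2)$ is compact for all compact $K_1,K_2\subseteq\mathbb H$. -/

import Mathlib

open MeasureTheory Set Filter
open scoped Topology ENNReal

/-- The Heisenberg group in exponential coordinates `(x, y, z) ↦ exp (x X + y Y + z Z)`. -/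
@[ext]
structure Heis where
  x : ℝ
  y : ℝ
  z : ℝ

namespace Heis

noncomputable section

/-- The group law given by the Campbell-Hausdorff formula. -/
instance : Mul Heis :=
  ⟨fun p q => ⟨p.x + q.x, p.y + q.y, p.z + q.z + (p.x * q.y - q.x * p.y) / 2⟩⟩

instance : One Heis := ⟨⟨0, 0, 0⟩⟩

instance : Inv Heis := ⟨fun p => ⟨-p.x, -p.y, -p.z⟩⟩

@[simp] theorem mul_x (p q : Heis) : (p * q).x = p.x + q.x := rfl
@[simp] theorem mul_y (p q : Heis) : (p * q).y = p.y + q.y := rfl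
@[simp] theorem mul_z (p q : Heis) :
    (p * q).z = p.z + q.z + (p.x * q.y - q.x * p.y) / 2 := rfl
@[simp] theorem one_x : (1 : Heis).x = 0 := rfl
@[simp] theorem one_y : (1 : Heis).y = 0 := rfl
@[simp] theorem one_z : (1 : Heis).z = 0 := rfl
@[simp] theorem inv_x (p : Heis) : (p⁻¹).x = -p.x := rfl
@[simp] theorem inv_y (p : Heis) : (p⁻¹).y = -p.y := rfl
@[simp] theorem inv_z (p : Heis) : (p⁻¹).z = -p.z := rfl

instance : Group Heis :=
  Group.ofLeftAxioms
    (by intro p q r; ext <;> simp <;> ring)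
    (by intro p; ext <;> simp)
    (by intro p; ext <;> simp [mul_comm])

/-- The global coordinates of a point. -/
def coords (q : Heis) : ℝ × ℝ × ℝ := (q.x, q.y, q.z)

theorem coords_injective : Function.Injective coords := by
  intro p q h
  simp only [coords, Prod.mk.injEq] at h
  exact Heis.ext h.1 h.2.1 h.2.2

/-- The left-invariant vector field `X = ∂_x - (y / 2) ∂_z`. -/
def X (q : Heis) : ℝ × ℝ × ℝ := (1, 0, -q.y / 2)

/-- The left-invariant vector field `Y = ∂_y + (x / 2) ∂_z`. -/
def Y (q : Heis) : ℝ × ℝ × ℝ := (0, 1, q.x / 2)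

/-! Horizontal vectors `u₁ X(q) + u₂ Y(q)` are represented by their components `u = (u₁, u₂)` in
the frame `(X, Y)`. -/

/-- The sub-Lorentzian metric on the distribution spanned by `X` and `Y`. -/
def lorentz (u v : ℝ × ℝ) : ℝ := u.2 * v.2 - u.1 * v.1

def IsTimelikeVec (u : ℝ × ℝ) : Prop := lorentz u u < 0

def IsCausalVec (u : ℝ × ℝ) : Prop := lorentz u u ≤ 0 ∧ u ≠ 0

/-- Future-directed: negative product with the time orientation `X`, whose components
are `(1, 0)`. -/
def IsFutureVec (u : ℝ × ℝ) : Prop := lorentz u (1, 0) < 0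

def IsPastVec (u : ℝ × ℝ) : Prop := 0 < lorentz u (1, 0)

/-- The curve `γ : [a, b] → ℍ`, `a < b`, is horizontal with control `u ∈ L^∞([a, b], ℝ²)`. Only the
values of `γ` and `u` on `[a, b]` matter. -/
structure IsHorizontal (γ : ℝ → Heis) (u : ℝ → ℝ × ℝ) (a b : ℝ) : Prop where
  lt : a < b
  absolutelyContinuous : AbsolutelyContinuousOnInterval (fun t => coords (γ t)) a b
  memLp : MemLp u ⊤ (volume.restrict (Icc a b))
  hasDerivAt : ∀ᵐ t ∂(volume.restrict (Icc a b)),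
    HasDerivAt (fun s => coords (γ s)) ((u t).1 • X (γ t) + (u t).2 • Y (γ t)) t

def IsFutureCausalCurve (γ : ℝ → Heis) (u : ℝ → ℝ × ℝ) (a b : ℝ) : Prop :=
  IsHorizontal γ u a b ∧ ∀ᵐ t ∂(volume.restrict (Icc a b)), IsCausalVec (u t) ∧ IsFutureVec (u t)

def IsPastCausalCurve (γ : ℝ → Heis) (u : ℝ → ℝ × ℝ) (a b : ℝ) : Prop :=
  IsHorizontal γ u a b ∧ ∀ᵐ t ∂(volume.restrict (Icc a b)), IsCausalVec (u t) ∧ IsPastVec (u t)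

def IsFutureTimelikeCurve (γ : ℝ → Heis) (u : ℝ → ℝ × ℝ) (a b : ℝ) : Prop :=
  IsHorizontal γ u a b ∧
    ∀ᵐ t ∂(volume.restrict (Icc a b)), IsTimelikeVec (u t) ∧ IsFutureVec (u t)

/-- A causal curve comes with one time orientation: it is future-directed or past-directed. -/
def IsCausalCurve (γ : ℝ → Heis) (u : ℝ → ℝ × ℝ) (a b : ℝ) : Prop :=
  IsFutureCausalCurve γ u a b ∨ IsPastCausalCurve γ u a b

/-- The sub-Riemannian length of a horizontal curve on `[a, b]` with control `u`. -/
def sRLength (u : ℝ → ℝ × ℝ) (a b : ℝ) : ℝ≥0∞ :=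
  ∫⁻ t in Icc a b, ENNReal.ofReal (Real.sqrt ((u t).1 ^ 2 + (u t).2 ^ 2))

/-- The sub-Riemannian distance: the infimum of the lengths of the horizontal curves that join
`p` to `q`. -/
def sRDist (p q : Heis) : ℝ≥0∞ :=
  sInf {L | ∃ (γ : ℝ → Heis) (u : ℝ → ℝ × ℝ) (a b : ℝ),
    IsHorizontal γ u a b ∧ γ a = p ∧ γ b = q ∧ L = sRLength u a b}

/-! ### The sub-Riemannian distance is symmetric and satisfies the triangle inequality -/

theorem ac_comp {f : ℝ → ℝ × ℝ × ℝ} {a b c d : ℝ} {g : ℝ → ℝ}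
    (hf : AbsolutelyContinuousOnInterval f a b)
    (hmaps : ∀ t ∈ uIcc c d, g t ∈ uIcc a b)
    (hlip : ∀ s t, dist (g s) (g t) ≤ dist s t)
    (hdisj : ∀ s t s' t', Disjoint (uIoc s t) (uIoc s' t') →
      Disjoint (uIoc (g s) (g t)) (uIoc (g s') (g t'))) :
    AbsolutelyContinuousOnInterval (fun t => f (g t)) c d := by
  rw [absolutelyContinuousOnInterval_iff] at hf ⊢
  intro ε hε
  obtain ⟨δ, hδ, h⟩ := hf ε hε
  refine ⟨δ, hδ, fun E hE hlen => ?_⟩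
  refine h (E.1, fun i => (g (E.2 i).1, g (E.2 i).2)) ⟨?_, ?_⟩ ?_
  · intro i hi
    exact ⟨hmaps _ (hE.1 i hi).1, hmaps _ (hE.1 i hi).2⟩
  · intro i hi j hj hij
    exact hdisj _ _ _ _ (hE.2 hi hj hij)
  · exact lt_of_le_of_lt (Finset.sum_le_sum fun i _ => hlip _ _) hlen

theorem IsHorizontal.const (q : Heis) : IsHorizontal (fun _ => q) (fun _ => 0) 0 1 where
  lt := one_pos
  absolutelyContinuous :=
    ((LipschitzWith.const (coords q)).lipschitzOnWith).absolutelyContinuousOnInterval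
  memLp := memLp_const 0
  hasDerivAt := by
    refine Eventually.of_forall fun t => ?_
    simpa using hasDerivAt_const t (coords q)

theorem sRLength_zero (a b : ℝ) : sRLength (fun _ => 0) a b = 0 := by
  simp [sRLength]

theorem IsHorizontal.translate {γ : ℝ → Heis} {u : ℝ → ℝ × ℝ} {a b : ℝ}
    (h : IsHorizontal γ u a b) (e : ℝ) :
    IsHorizontal (fun t => γ (t + e)) (fun t => u (t + e)) (a - e) (b - e) := by
  have hpre : (fun t : ℝ => t + e) ⁻¹' Icc a b = Icc (a - e) (b - e) := by
    ext t; simp [le_sub_iff_add_le]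
  have hmp := (measurePreserving_add_right (volume : Measure ℝ) e).restrict_preimage_emb
    (measurableEmbedding_addRight e) (Icc a b)
  rw [hpre] at hmp
  refine ⟨by linarith [h.lt], ?_, h.memLp.comp_measurePreserving hmp, ?_⟩
  · refine ac_comp (f := fun t => coords (γ t)) (g := fun t => t + e) h.absolutelyContinuous ?_ ?_ ?_
    · intro t ht
      rw [uIcc_of_le (by linarith [h.lt])] at ht
      rw [uIcc_of_le h.lt.le]
      exact ⟨by linarith [ht.1], by linarith [ht.2]⟩
    · intro s t; simp
    · intro s t s' t' hd
      simp only [uIoc, Ioc_disjoint_Ioc] at hd ⊢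
      simp only [min_add_add_right, max_add_add_right]
      linarith
  · filter_upwards [hmp.quasiMeasurePreserving.ae h.hasDerivAt] with t ht
    exact ht.comp_add_const t e

theorem sRLength_translate (u : ℝ → ℝ × ℝ) (a b e : ℝ) :
    sRLength (fun t => u (t + e)) (a - e) (b - e) = sRLength u a b := by
  have hpre : (fun t : ℝ => t + e) ⁻¹' Icc a b = Icc (a - e) (b - e) := by
    ext t; simp [le_sub_iff_add_le]
  have := (measurePreserving_add_right (volume : Measure ℝ) e).setLIntegral_comp_preimage_emb
    (measurableEmbedding_addRight e)
    (fun t => ENNReal.ofReal (Real.sqrt ((u t).1 ^ 2 + (u t).2 ^ 2))) (Icc a b)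
  rw [hpre] at this
  exact this

theorem IsHorizontal.reverse {γ : ℝ → Heis} {u : ℝ → ℝ × ℝ} {a b : ℝ}
    (h : IsHorizontal γ u a b) :
    IsHorizontal (fun t => γ (-t)) (fun t => -u (-t)) (-b) (-a) := by
  have hpre : (fun t : ℝ => -t) ⁻¹' Icc a b = Icc (-b) (-a) := by
    ext t; simp [and_comm]
  have hmp := (Measure.measurePreserving_neg (volume : Measure ℝ)).restrict_preimage_emb
    (MeasurableEquiv.neg ℝ).measurableEmbedding (Icc a b)
  change MeasurePreserving _ (volume.restrict ((fun t : ℝ => -t) ⁻¹' Icc a b)) _ at hmp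
  rw [hpre] at hmp
  refine ⟨by linarith [h.lt], ?_, (h.memLp.comp_measurePreserving hmp).neg, ?_⟩
  · refine ac_comp (f := fun t => coords (γ t)) (g := fun t => -t) h.absolutelyContinuous ?_ ?_ ?_
    · intro t ht
      rw [uIcc_of_le (by linarith [h.lt])] at ht
      rw [uIcc_of_le h.lt.le]
      exact ⟨by linarith [ht.2], by linarith [ht.1]⟩
    · intro s t; simp [dist_neg_neg]
    · intro s t s' t' hd
      simp only [uIoc, Ioc_disjoint_Ioc] at hd ⊢
      grind
  · filter_upwards [hmp.quasiMeasurePreserving.ae h.hasDerivAt] with t ht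
    have := HasDerivAt.scomp t ht (hasDerivAt_neg t)
    have e : (-u (-t)).1 • X (γ (-t)) + (-u (-t)).2 • Y (γ (-t)) =
        (-1 : ℝ) • ((u (-t)).1 • X (γ (-t)) + (u (-t)).2 • Y (γ (-t))) := by
      rw [Prod.fst_neg, Prod.snd_neg]
      module
    rw [e]
    exact this

theorem sRLength_reverse (u : ℝ → ℝ × ℝ) (a b : ℝ) :
    sRLength (fun t => -u (-t)) (-b) (-a) = sRLength u a b := by
  have hpre : (fun t : ℝ => -t) ⁻¹' Icc a b = Icc (-b) (-a) := by
    ext t; simp [and_comm]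
  have := (Measure.measurePreserving_neg (volume : Measure ℝ)).setLIntegral_comp_preimage_emb
    (MeasurableEquiv.neg ℝ).measurableEmbedding
    (fun t => ENNReal.ofReal (Real.sqrt ((u t).1 ^ 2 + (u t).2 ^ 2))) (Icc a b)
  change ∫⁻ t in ((fun t : ℝ => -t) ⁻¹' Icc a b), _ = _ at this
  rw [hpre] at this
  simpa [sRLength] using this

theorem IsHorizontal.concat {γ₁ γ₂ : ℝ → Heis} {u₁ u₂ : ℝ → ℝ × ℝ} {a b c : ℝ}
    (h₁ : IsHorizontal γ₁ u₁ a b) (h₂ : IsHorizontal γ₂ u₂ b c) (hb : γ₁ b = γ₂ b) :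
    IsHorizontal (fun t => if t ≤ b then γ₁ t else γ₂ t)
      (fun t => if t ≤ b then u₁ t else u₂ t) a c := by
  have hab := h₁.lt
  have hbc := h₂.lt
  have hsplit : ∀ {P : ℝ → Prop}, (∀ᵐ t ∂(volume.restrict (Icc a c)), P t) ↔
      ∀ᵐ t : ℝ, t ∈ Icc a c → P t := fun {P} => ae_restrict_iff' measurableSet_Icc
  have hne : ∀ᵐ t : ℝ, t ≠ b := by
    simp [ae_iff]
  refine ⟨hab.trans hbc, ?_, ?_, ?_⟩
  · have e : (fun t => coords (if t ≤ b then γ₁ t else γ₂ t)) =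
        ((fun t => coords (γ₁ (min t b))) + (fun t => coords (γ₂ (max t b)))) -
          (fun _ => coords (γ₂ b)) := by
      funext t
      by_cases ht : t ≤ b
      · simp [ht]
      · have ht' : b ≤ t := (not_le.mp ht).le
        simp [ht, ht', hb]
    rw [e]
    refine AbsolutelyContinuousOnInterval.sub (AbsolutelyContinuousOnInterval.add ?_ ?_)
      ((LipschitzWith.const (coords (γ₂ b))).lipschitzOnWith).absolutelyContinuousOnInterval
    · refine ac_comp (f := fun t => coords (γ₁ t)) (g := fun t => min t b) h₁.absolutelyContinuous ?_ ?_ ?_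
      · intro t ht
        rw [uIcc_of_le (by linarith)] at ht
        rw [uIcc_of_le hab.le]
        exact ⟨le_min ht.1 hab.le, min_le_right _ _⟩
      · intro s t
        simpa [Real.dist_eq] using abs_min_sub_min_le_max s b t b
      · intro s t s' t' hd
        refine hd.mono ?_ ?_ <;>
        · intro r hr
          simp only [uIoc, mem_Ioc] at hr ⊢
          grind
    · refine ac_comp (f := fun t => coords (γ₂ t)) (g := fun t => max t b) h₂.absolutelyContinuous ?_ ?_ ?_
      · intro t ht
        rw [uIcc_of_le (by linarith)] at ht
        rw [uIcc_of_le hbc.le]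
        exact ⟨le_max_right _ _, max_le ht.2 hbc.le⟩
      · intro s t
        simpa [Real.dist_eq] using abs_max_sub_max_le_max s b t b
      · intro s t s' t' hd
        refine hd.mono ?_ ?_ <;>
        · intro r hr
          simp only [uIoc, mem_Ioc] at hr ⊢
          grind
  · have hp : MemLp ((Iic b).piecewise u₁ u₂) ⊤ (volume.restrict (Icc a c)) := by
      refine MemLp.piecewise measurableSet_Iic ?_ ?_
      · refine h₁.memLp.mono_measure ?_
        rw [Measure.restrict_restrict measurableSet_Iic]
        refine Measure.restrict_mono ?_ le_rfl
        exact fun t ht => ⟨ht.2.1, ht.1⟩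
      · refine h₂.memLp.mono_measure ?_
        rw [Measure.restrict_restrict measurableSet_Iic.compl]
        refine Measure.restrict_mono ?_ le_rfl
        exact fun t ht => ⟨(not_le.mp (mem_Iic.not.mp ht.1)).le, ht.2.2⟩
    exact hp
  · have d₁ := (ae_restrict_iff' measurableSet_Icc).mp h₁.hasDerivAt
    have d₂ := (ae_restrict_iff' measurableSet_Icc).mp h₂.hasDerivAt
    rw [hsplit]
    filter_upwards [d₁, d₂, hne] with t t₁ t₂ tb htI
    rcases lt_or_gt_of_ne tb with hlt | hgt
    · have := t₁ ⟨htI.1, hlt.le⟩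
      simp only [hlt.le, if_true]
      refine this.congr_of_eventuallyEq ?_
      filter_upwards [Iio_mem_nhds hlt] with s hs
      have hs' : s ≤ b := le_of_lt hs
      simp [hs']
    · have := t₂ ⟨hgt.le, htI.2⟩
      simp only [not_le.mpr hgt, if_false]
      refine this.congr_of_eventuallyEq ?_
      filter_upwards [Ioi_mem_nhds hgt] with s hs
      have hs' : ¬ s ≤ b := not_le.mpr hs
      simp [hs']

theorem sRLength_concat_le (u₁ u₂ : ℝ → ℝ × ℝ) (a b c : ℝ) :
    sRLength (fun t => if t ≤ b then u₁ t else u₂ t) a c ≤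
      sRLength u₁ a b + sRLength u₂ b c := by
  set w : ℝ → ℝ × ℝ := fun t => if t ≤ b then u₁ t else u₂ t with hw
  have hsub : Icc a c ⊆ Icc a b ∪ Ioc b c := by
    intro t ht
    rcases le_or_gt t b with h | h
    · exact Or.inl ⟨ht.1, h⟩
    · exact Or.inr ⟨h, ht.2⟩
  have e₁ : sRLength w a b = sRLength u₁ a b := by
    refine setLIntegral_congr_fun measurableSet_Icc fun t ht => ?_
    simp [hw, ht.2]
  have e₂ : (∫⁻ t in Ioc b c, ENNReal.ofReal (Real.sqrt ((w t).1 ^ 2 + (w t).2 ^ 2))) =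
      ∫⁻ t in Ioc b c, ENNReal.ofReal (Real.sqrt ((u₂ t).1 ^ 2 + (u₂ t).2 ^ 2)) := by
    refine setLIntegral_congr_fun measurableSet_Ioc fun t ht => ?_
    simp [hw, not_le.mpr ht.1]
  calc sRLength w a c ≤ _ := (lintegral_mono_set hsub).trans (lintegral_union_le _ _ _)
    _ ≤ _ := by
      rw [e₂]
      exact add_le_add e₁.le (lintegral_mono_set Ioc_subset_Icc_self)

theorem IsHorizontal.sRDist_le {γ : ℝ → Heis} {u : ℝ → ℝ × ℝ} {a b : ℝ}
    (h : IsHorizontal γ u a b) : sRDist (γ a) (γ b) ≤ sRLength u a b :=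
  sInf_le ⟨γ, u, a, b, h, rfl, rfl, rfl⟩

theorem sRDist_self (p : Heis) : sRDist p p = 0 :=
  le_antisymm (sInf_le ⟨_, _, 0, 1, IsHorizontal.const p, rfl, rfl, (sRLength_zero 0 1).symm⟩)
    zero_le

theorem sRDist_comm_le (p q : Heis) : sRDist p q ≤ sRDist q p := by
  refine le_sInf ?_
  rintro L ⟨γ, u, a, b, h, ha, hb, rfl⟩
  exact sInf_le ⟨_, _, -b, -a, h.reverse, by simpa using hb, by simpa using ha,
    (sRLength_reverse u a b).symm⟩

theorem sRDist_triangle (p q r : Heis) : sRDist p r ≤ sRDist p q + sRDist q r := by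
  unfold sRDist
  rw [ENNReal.sInf_add]
  refine le_iInf₂ ?_
  rintro L₁ ⟨γ₁, u₁, a, b, h₁, ha, hb, rfl⟩
  rw [add_comm, ENNReal.sInf_add]
  refine le_iInf₂ ?_
  rintro L₂ ⟨γ₂, u₂, c, d, h₂, hc, hd, rfl⟩
  have h₂' := h₂.translate (c - b)
  have hl := sRLength_translate u₂ c d (c - b)
  rw [sub_sub_cancel] at h₂' hl
  have hcat := h₁.concat h₂' (by simp [hb, hc])
  have key := hcat.sRDist_le.trans (sRLength_concat_le _ _ _ _ _)
  simp only [h₁.lt.le, not_le.mpr h₂'.lt, if_true, if_false, sub_add_cancel, ha, hd, hl] at key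
  rw [add_comm]
  exact key

/-- The metric structure and the topology on the Heisenberg group are those of the sub-Riemannian
distance. -/
instance : PseudoEMetricSpace Heis where
  edist := sRDist
  edist_self := sRDist_self
  edist_comm p q := le_antisymm (sRDist_comm_le p q) (sRDist_comm_le q p)
  edist_triangle := sRDist_triangle

/-! ### Causal structure -/

/-- The causal relation `p ≤ q`: the points are equal or a future-directed causal curve joins `p`
to `q`. -/
def CausalRel (p q : Heis) : Prop :=
  p = q ∨ ∃ (γ : ℝ → Heis) (u : ℝ → ℝ × ℝ) (a b : ℝ),
    IsFutureCausalCurve γ u a b ∧ γ a = p ∧ γ b = q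

/-- The timelike relation `p ≪ q`. -/
def TimelikeRel (p q : Heis) : Prop :=
  ∃ (γ : ℝ → Heis) (u : ℝ → ℝ × ℝ) (a b : ℝ),
    IsFutureTimelikeCurve γ u a b ∧ γ a = p ∧ γ b = q

/-- The causal future `J⁺(A)`. -/
def causalFuture (A : Set Heis) : Set Heis := {q | ∃ p ∈ A, CausalRel p q}

/-- The causal past `J⁻(A)`. -/
def causalPast (A : Set Heis) : Set Heis := {p | ∃ q ∈ A, CausalRel p q}

/-- The chronological future `I⁺(A)`. -/
def chronologicalFuture (A : Set Heis) : Set Heis := {q | ∃ p ∈ A, TimelikeRel p q}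

/-- The chronological past `I⁻(A)`. -/
def chronologicalPast (A : Set Heis) : Set Heis := {p | ∃ q ∈ A, TimelikeRel p q}

/-- The topology generated by the subbase of all `I⁺(p) ∩ I⁻(q)`. -/
abbrev alexandrovTopology : TopologicalSpace Heis :=
  TopologicalSpace.generateFrom
    {S | ∃ p q : Heis, S = chronologicalFuture {p} ∩ chronologicalPast {q}}

def StronglyCausal : Prop :=
  alexandrovTopology = (inferInstance : TopologicalSpace Heis)

def CausallyClosed : Prop :=
  IsClosed {pq : Heis × Heis | CausalRel pq.1 pq.2}

/-- Every point has a neighbourhood in which the causal curves have uniformly bounded length with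
respect to the sub-Riemannian distance. -/
def CompatibleWithDist : Prop :=
  ∀ q : Heis, ∃ U ∈ 𝓝 q, ∃ C : ℝ, 0 < C ∧
    ∀ (γ : ℝ → Heis) (u : ℝ → ℝ × ℝ) (a b : ℝ),
      IsCausalCurve γ u a b → MapsTo γ (Icc a b) U → eVariationOn γ (Icc a b) ≤ ENNReal.ofReal C

def NonTotallyImprisoning : Prop :=
  ∀ K : Set Heis, IsCompact K → ∃ C : ℝ, 0 < C ∧
    ∀ (γ : ℝ → Heis) (u : ℝ → ℝ × ℝ) (a b : ℝ),
      IsCausalCurve γ u a b → MapsTo γ (Icc a b) K → sRLength u a b ≤ ENNReal.ofReal C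

def GloballyHyperbolic : Prop :=
  NonTotallyImprisoning ∧ ∀ p q : Heis, IsCompact (causalFuture {p} ∩ causalPast {q})

def KGloballyHyperbolic : Prop :=
  NonTotallyImprisoning ∧ ∀ K₁ K₂ : Set Heis, IsCompact K₁ → IsCompact K₂ →
    IsCompact (causalFuture K₁ ∩ causalPast K₂)

end

end Heis

namespace Heis

/-! ### Absolutely continuous functions and their derivatives -/

/-! Left translations preserve controls, so everything reduces to curves issuing from the identity,
and the causal structure becomes explicit. With `r = p⁻¹ * q`, the relation `p ≤ q` means `|y| ≤ x`
and `4|z| ≤ x² - y²` for the coordinates of `r`, and `p ≪ q` is the same with strict inequalities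
(`causalRel_iff`, `timelikeRel_iff`). Necessity is monotonicity: along a causal curve from the
identity, `x ± y` and `x² - y² ∓ 4z` are nondecreasing. Sufficiency is a construction: two
consecutive segments of one-parameter subgroups reach every point of the solid cone.

The distance is comparable to a homogeneous gauge: `|x|`, `|y|` and `√|z|` of `p⁻¹ * q` are at most
`d(p, q)`, which in turn is at most `|x| + |y| + 4√|z|`. Hence the coordinates are a homeomorphism
onto `ℝ³`, so `≤` is closed and `≪` is open. Small chronological diamonds around a point lie in
small balls, which is strong causality.

A causal control satisfies `|u₂| ≤ |u₁|` with `u₁` of constant sign, so the length of a causal curve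
is at most twice the increment of `x`. This gives compatibility with `d` and non-total imprisonment.
Causal diamonds of compact sets have bounded coordinates, and closedness of `≤` makes them compact.
-/

theorem ac_comp_lipschitz {E F : Type*} [PseudoMetricSpace E] [PseudoMetricSpace F] {f : ℝ → E}
    {φ : E → F} {a b : ℝ} (hf : AbsolutelyContinuousOnInterval f a b) (hφ : LipschitzWith 1 φ) :
    AbsolutelyContinuousOnInterval (fun t => φ (f t)) a b := by
  rw [absolutelyContinuousOnInterval_iff] at hf ⊢
  intro ε hε
  obtain ⟨δ, hδ, h⟩ := hf ε hε
  refine ⟨δ, hδ, fun E hE hlen => lt_of_le_of_lt (Finset.sum_le_sum fun i _ => ?_) (h E hE hlen)⟩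
  simpa using hφ.dist_le_mul (f (E.2 i).1) (f (E.2 i).2)

theorem ac_const (c a b : ℝ) : AbsolutelyContinuousOnInterval (fun _ => c) a b :=
  ((LipschitzWith.const c).lipschitzOnWith).absolutelyContinuousOnInterval

section Calculus

variable {f f' : ℝ → ℝ} {a b : ℝ}

theorem deriv_ae_eq (hd : ∀ᵐ t ∂(volume.restrict (Icc a b)), HasDerivAt f (f' t) t) :
    deriv f =ᵐ[volume.restrict (Ioc a b)] f' := by
  filter_upwards [ae_restrict_of_ae_restrict_of_subset Ioc_subset_Icc_self hd] with t ht
  exact ht.deriv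

theorem integrableOn_of_hasDerivAt (hab : a ≤ b) (hf : AbsolutelyContinuousOnInterval f a b)
    (hd : ∀ᵐ t ∂(volume.restrict (Icc a b)), HasDerivAt f (f' t) t) :
    Integrable f' (volume.restrict (Ioc a b)) :=
  ((intervalIntegrable_iff_integrableOn_Ioc_of_le hab).mp hf.intervalIntegrable_deriv).congr
    (deriv_ae_eq hd)

theorem integral_of_hasDerivAt (hab : a ≤ b) (hf : AbsolutelyContinuousOnInterval f a b)
    (hd : ∀ᵐ t ∂(volume.restrict (Icc a b)), HasDerivAt f (f' t) t) :
    ∫ t in Ioc a b, f' t = f b - f a := by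
  rw [← hf.integral_deriv_eq_sub, intervalIntegral.integral_of_le hab]
  exact (integral_congr_ae (deriv_ae_eq hd)).symm

theorem ofReal_abs_sub_le_lintegral (hab : a ≤ b) (hf : AbsolutelyContinuousOnInterval f a b)
    (hd : ∀ᵐ t ∂(volume.restrict (Icc a b)), HasDerivAt f (f' t) t) :
    ENNReal.ofReal |f b - f a| ≤ ∫⁻ t in Icc a b, ENNReal.ofReal |f' t| := by
  rw [← integral_of_hasDerivAt hab hf hd, ← Real.enorm_eq_ofReal_abs]
  refine (enorm_integral_le_lintegral_enorm _).trans ?_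
  simp only [Real.enorm_eq_ofReal_abs]
  exact lintegral_mono_set Ioc_subset_Icc_self

theorem lintegral_eq_ofReal_sub (hab : a ≤ b) (hf : AbsolutelyContinuousOnInterval f a b)
    (hd : ∀ᵐ t ∂(volume.restrict (Icc a b)), HasDerivAt f (f' t) t)
    (h0 : ∀ᵐ t ∂(volume.restrict (Icc a b)), 0 ≤ f' t) :
    ∫⁻ t in Icc a b, ENNReal.ofReal (f' t) = ENNReal.ofReal (f b - f a) := by
  rw [← integral_of_hasDerivAt hab hf hd, ← setLIntegral_congr Ioc_ae_eq_Icc,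
    ofReal_integral_eq_lintegral_ofReal (integrableOn_of_hasDerivAt hab hf hd)
      (ae_restrict_of_ae_restrict_of_subset Ioc_subset_Icc_self h0)]

theorem le_of_hasDerivAt_nonneg (hab : a ≤ b) (hf : AbsolutelyContinuousOnInterval f a b)
    (hd : ∀ᵐ t ∂(volume.restrict (Icc a b)), HasDerivAt f (f' t) t)
    (h0 : ∀ᵐ t ∂(volume.restrict (Icc a b)), 0 ≤ f' t) : f a ≤ f b := by
  rw [← sub_nonneg, ← integral_of_hasDerivAt hab hf hd]
  exact integral_nonneg_of_ae (ae_restrict_of_ae_restrict_of_subset Ioc_subset_Icc_self h0)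

theorem lt_of_hasDerivAt_pos (hab : a < b) (hf : AbsolutelyContinuousOnInterval f a b)
    (hd : ∀ᵐ t ∂(volume.restrict (Icc a b)), HasDerivAt f (f' t) t)
    (h0 : ∀ᵐ t ∂(volume.restrict (Icc a b)), 0 < f' t) : f a < f b := by
  have h0' := ae_restrict_of_ae_restrict_of_subset Ioc_subset_Icc_self h0
  rw [← sub_pos, ← integral_of_hasDerivAt hab.le hf hd]
  refine lt_of_le_of_ne (integral_nonneg_of_ae (h0'.mono fun _ h => h.le)) fun h => ?_
  have hz := (integral_eq_zero_iff_of_nonneg_ae (h0'.mono fun _ h => h.le)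
    (integrableOn_of_hasDerivAt hab.le hf hd)).mp h.symm
  -- The integrand would be both positive and zero almost everywhere, so the interval would be null,
  -- contradicting `a < b`.
  have hF : ∀ᵐ _ ∂(volume.restrict (Ioc a b)), False := by
    filter_upwards [h0', hz] with t h1 h2
    exact h1.ne' h2
  rw [eventually_false_iff_eq_bot, ae_eq_bot, Measure.restrict_eq_zero] at hF
  simp only [Real.volume_Ioc, ENNReal.ofReal_eq_zero] at hF
  linarith

end Calculus

/-! ### Horizontal curves in coordinates -/

section Horizontal

variable {γ : ℝ → Heis} {u : ℝ → ℝ × ℝ} {a b : ℝ}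

theorem IsHorizontal.mono (h : IsHorizontal γ u a b) {c d : ℝ} (hac : a ≤ c) (hcd : c < d)
    (hdb : d ≤ b) : IsHorizontal γ u c d where
  lt := hcd
  absolutelyContinuous := h.absolutelyContinuous.mono (by
    rw [uIcc_of_le hcd.le, uIcc_of_le h.lt.le]
    exact Icc_subset_Icc hac hdb)
  memLp := h.memLp.mono_measure (Measure.restrict_mono (Icc_subset_Icc hac hdb) le_rfl)
  hasDerivAt := ae_restrict_of_ae_restrict_of_subset (Icc_subset_Icc hac hdb) h.hasDerivAt

theorem IsHorizontal.ac_x (h : IsHorizontal γ u a b) :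
    AbsolutelyContinuousOnInterval (fun t => (γ t).x) a b :=
  ac_comp_lipschitz (φ := Prod.fst) h.absolutelyContinuous LipschitzWith.prod_fst

theorem IsHorizontal.ac_y (h : IsHorizontal γ u a b) :
    AbsolutelyContinuousOnInterval (fun t => (γ t).y) a b :=
  ac_comp_lipschitz (φ := Prod.fst)
    (ac_comp_lipschitz (φ := Prod.snd) h.absolutelyContinuous LipschitzWith.prod_snd)
    LipschitzWith.prod_fst

theorem IsHorizontal.ac_z (h : IsHorizontal γ u a b) :
    AbsolutelyContinuousOnInterval (fun t => (γ t).z) a b :=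
  ac_comp_lipschitz (φ := Prod.snd)
    (ac_comp_lipschitz (φ := Prod.snd) h.absolutelyContinuous LipschitzWith.prod_snd)
    LipschitzWith.prod_snd

theorem hasDerivAt_components {v : ℝ × ℝ} {t : ℝ} (h : HasDerivAt (fun s => coords (γ s))
    (v.1 • X (γ t) + v.2 • Y (γ t)) t) :
    HasDerivAt (fun s => (γ s).x) v.1 t ∧ HasDerivAt (fun s => (γ s).y) v.2 t ∧
      HasDerivAt (fun s => (γ s).z) (((γ t).x * v.2 - (γ t).y * v.1) / 2) t := by
  have h1 := (hasFDerivAt_fst (𝕜 := ℝ)).comp_hasDerivAt t h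
  have h2 := (hasFDerivAt_snd (𝕜 := ℝ)).comp_hasDerivAt t h
  have h3 := (hasFDerivAt_fst (𝕜 := ℝ)).comp_hasDerivAt t h2
  have h4 := (hasFDerivAt_snd (𝕜 := ℝ)).comp_hasDerivAt t h2
  refine ⟨?_, ?_, ?_⟩
  · refine h1.congr_deriv ?_
    simp [X, Y]
  · refine h3.congr_deriv ?_
    simp [X, Y]
  · refine h4.congr_deriv ?_
    simp [X, Y]
    ring

theorem hasDerivAt_coords {v : ℝ × ℝ} {t : ℝ} (hx : HasDerivAt (fun s => (γ s).x) v.1 t)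
    (hy : HasDerivAt (fun s => (γ s).y) v.2 t)
    (hz : HasDerivAt (fun s => (γ s).z) (((γ t).x * v.2 - (γ t).y * v.1) / 2) t) :
    HasDerivAt (fun s => coords (γ s)) (v.1 • X (γ t) + v.2 • Y (γ t)) t := by
  refine (hx.prodMk (hy.prodMk hz)).congr_deriv ?_
  simp [X, Y]
  ring

theorem ac_prodMk {E F : Type*} [PseudoMetricSpace E] [PseudoMetricSpace F] {f : ℝ → E}
    {g : ℝ → F} (hf : AbsolutelyContinuousOnInterval f a b)
    (hg : AbsolutelyContinuousOnInterval g a b) :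
    AbsolutelyContinuousOnInterval (fun t => (f t, g t)) a b := by
  rw [absolutelyContinuousOnInterval_iff] at hf hg ⊢
  intro ε hε
  obtain ⟨δ₁, hδ₁, h₁⟩ := hf (ε / 2) (half_pos hε)
  obtain ⟨δ₂, hδ₂, h₂⟩ := hg (ε / 2) (half_pos hε)
  refine ⟨min δ₁ δ₂, lt_min hδ₁ hδ₂, fun E hE hlen => ?_⟩
  have k₁ := h₁ E hE (hlen.trans_le (min_le_left _ _))
  have k₂ := h₂ E hE (hlen.trans_le (min_le_right _ _))
  calc _ ≤ ∑ i ∈ Finset.range E.1, (dist (f (E.2 i).1) (f (E.2 i).2) +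
        dist (g (E.2 i).1) (g (E.2 i).2)) := Finset.sum_le_sum fun i _ => by
          rw [Prod.dist_eq]
          exact max_le_add_of_nonneg dist_nonneg dist_nonneg
    _ < ε := by
          rw [Finset.sum_add_distrib]
          linarith

/-- Left translations preserve horizontality, with the same control. -/
theorem IsHorizontal.mul_left (h : IsHorizontal γ u a b) (p : Heis) :
    IsHorizontal (fun t => p * γ t) u a b where
  lt := h.lt
  memLp := h.memLp
  absolutelyContinuous := by
    refine ac_prodMk ((ac_const _ _ _).fun_add h.ac_x)
      (ac_prodMk ((ac_const _ _ _).fun_add h.ac_y) ?_)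
    have := ((ac_const p.z a b).fun_add h.ac_z).fun_add
      (((h.ac_y.const_mul p.x).fun_sub (h.ac_x.const_mul p.y)).const_mul (1 / 2))
    have e : (fun t => (p * γ t).z) =
        fun t => p.z + (γ t).z + 1 / 2 * (p.x * (γ t).y - p.y * (γ t).x) := by
      funext t
      simp
      ring
    change AbsolutelyContinuousOnInterval (fun t => (p * γ t).z) a b
    rw [e]
    exact this
  hasDerivAt := by
    filter_upwards [h.hasDerivAt] with t ht
    obtain ⟨hx, hy, hz⟩ := hasDerivAt_components ht
    refine hasDerivAt_coords ?_ ?_ ?_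
    · exact hx.const_add p.x
    · exact hy.const_add p.y
    · refine ((hz.const_add p.z).add (((hy.const_mul p.x).sub
        (hx.mul_const p.y)).div_const 2)).congr_deriv ?_
      simp
      ring

theorem lorentz_self (v : ℝ × ℝ) : lorentz v v = (v.2 - v.1) * (v.2 + v.1) := by
  simp [lorentz]
  ring

theorem abs_le_of_causal {v : ℝ × ℝ} (h : IsCausalVec v) (hf : IsFutureVec v) : |v.2| ≤ v.1 := by
  have h0 : 0 < v.1 := by simpa [IsFutureVec, lorentz] using hf
  have h1 := h.1
  simp only [lorentz] at h1
  exact abs_le_of_sq_le_sq (by nlinarith) h0.le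

theorem abs_lt_of_timelike {v : ℝ × ℝ} (h : IsTimelikeVec v) (hf : IsFutureVec v) :
    |v.2| < v.1 := by
  have h0 : 0 < v.1 := by simpa [IsFutureVec, lorentz] using hf
  simp only [IsTimelikeVec, lorentz] at h
  exact abs_lt_of_sq_lt_sq (by nlinarith) h0.le

/-- The end point of a causal curve that starts at the identity. -/
theorem IsHorizontal.cone_le (h : IsHorizontal γ u a b) (h1 : γ a = 1)
    (hu : ∀ᵐ t ∂(volume.restrict (Icc a b)), |(u t).2| ≤ (u t).1) :
    |(γ b).y| ≤ (γ b).x ∧ 4 * |(γ b).z| ≤ (γ b).x ^ 2 - (γ b).y ^ 2 := by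
  -- `x ± y` has derivative `u₁ ± u₂ ≥ 0`. All intermediate times are needed, because the sign of `x
  -- ± y` enters the next derivative.
  have hyx : ∀ t ∈ Icc a b, |(γ t).y| ≤ (γ t).x := by
    intro t ht
    rcases ht.1.eq_or_lt with rfl | hat
    · simp [h1]
    have ht' := h.mono le_rfl hat ht.2
    have hu' := ae_restrict_of_ae_restrict_of_subset (Icc_subset_Icc_right ht.2) hu
    have k1 : (γ a).x + (γ a).y ≤ (γ t).x + (γ t).y :=
      le_of_hasDerivAt_nonneg (f := fun s => (γ s).x + (γ s).y) (f' := fun s => (u s).1 + (u s).2)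
        hat.le (ht'.ac_x.fun_add ht'.ac_y)
        (by
          filter_upwards [ht'.hasDerivAt] with s hs
          obtain ⟨hx, hy, -⟩ := hasDerivAt_components hs
          exact hx.add hy)
        (by
          filter_upwards [hu'] with s hs
          linarith [(abs_le.mp hs).1])
    have k2 : (γ a).x - (γ a).y ≤ (γ t).x - (γ t).y :=
      le_of_hasDerivAt_nonneg (f := fun s => (γ s).x - (γ s).y) (f' := fun s => (u s).1 - (u s).2)
        hat.le (ht'.ac_x.fun_sub ht'.ac_y)
        (by
          filter_upwards [ht'.hasDerivAt] with s hs
          obtain ⟨hx, hy, -⟩ := hasDerivAt_components hs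
          exact hx.sub hy)
        (by
          filter_upwards [hu'] with s hs
          linarith [(abs_le.mp hs).2])
    simp only [h1, one_x, one_y] at k1 k2
    exact abs_le.mpr ⟨by linarith, by linarith⟩
  refine ⟨hyx b ⟨h.lt.le, le_rfl⟩, ?_⟩
  -- For `σ² = 1` the derivative of `x² - y² - 4σz` factors as `2(x + σy)(u₁ - σu₂)`, a product of
  -- nonnegative terms.
  have key : ∀ σ : ℝ, σ = 1 ∨ σ = -1 → (γ a).x * (γ a).x - (γ a).y * (γ a).y - 4 * σ * (γ a).z ≤
      (γ b).x * (γ b).x - (γ b).y * (γ b).y - 4 * σ * (γ b).z := by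
    intro σ hσ
    refine le_of_hasDerivAt_nonneg
      (f := fun s => (γ s).x * (γ s).x - (γ s).y * (γ s).y - 4 * σ * (γ s).z)
      (f' := fun s => 2 * ((γ s).x + σ * (γ s).y) * ((u s).1 - σ * (u s).2)) h.lt.le
      (((h.ac_x.fun_mul h.ac_x).fun_sub (h.ac_y.fun_mul h.ac_y)).fun_sub
        (h.ac_z.const_mul (4 * σ))) ?_ ?_
    · filter_upwards [h.hasDerivAt] with s hs
      obtain ⟨hx, hy, hz⟩ := hasDerivAt_components hs
      refine (((hx.mul hx).sub (hy.mul hy)).sub (hz.const_mul (4 * σ))).congr_deriv ?_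
      rcases hσ with rfl | rfl <;> ring
    · filter_upwards [hu, ae_restrict_mem measurableSet_Icc] with s hs hm
      have k := abs_le.mp (hyx s hm)
      have l := abs_le.mp hs
      refine mul_nonneg (mul_nonneg two_pos.le ?_) ?_ <;>
        rcases hσ with rfl | rfl <;> linarith
  have e1 := key 1 (Or.inl rfl)
  have e2 := key (-1) (Or.inr rfl)
  simp only [h1, one_x, one_y, one_z] at e1 e2
  have : |(γ b).z| ≤ ((γ b).x ^ 2 - (γ b).y ^ 2) / 4 := abs_le.mpr ⟨by linarith, by linarith⟩
  linarith

/-- The end point of a timelike curve that starts at the identity. -/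
theorem IsHorizontal.cone_lt (h : IsHorizontal γ u a b) (h1 : γ a = 1)
    (hu : ∀ᵐ t ∂(volume.restrict (Icc a b)), |(u t).2| < (u t).1) :
    |(γ b).y| < (γ b).x ∧ 4 * |(γ b).z| < (γ b).x ^ 2 - (γ b).y ^ 2 := by
  have hyx : ∀ t ∈ Ioc a b, |(γ t).y| < (γ t).x := by
    intro t ht
    have ht' := h.mono le_rfl ht.1 ht.2
    have hu' := ae_restrict_of_ae_restrict_of_subset (Icc_subset_Icc_right ht.2) hu
    have k1 : (γ a).x + (γ a).y < (γ t).x + (γ t).y :=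
      lt_of_hasDerivAt_pos (f := fun s => (γ s).x + (γ s).y) (f' := fun s => (u s).1 + (u s).2)
        ht.1 (ht'.ac_x.fun_add ht'.ac_y)
        (by
          filter_upwards [ht'.hasDerivAt] with s hs
          obtain ⟨hx, hy, -⟩ := hasDerivAt_components hs
          exact hx.add hy)
        (by
          filter_upwards [hu'] with s hs
          linarith [(abs_lt.mp hs).1])
    have k2 : (γ a).x - (γ a).y < (γ t).x - (γ t).y :=
      lt_of_hasDerivAt_pos (f := fun s => (γ s).x - (γ s).y) (f' := fun s => (u s).1 - (u s).2)
        ht.1 (ht'.ac_x.fun_sub ht'.ac_y)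
        (by
          filter_upwards [ht'.hasDerivAt] with s hs
          obtain ⟨hx, hy, -⟩ := hasDerivAt_components hs
          exact hx.sub hy)
        (by
          filter_upwards [hu'] with s hs
          linarith [(abs_lt.mp hs).2])
    simp only [h1, one_x, one_y] at k1 k2
    exact abs_lt.mpr ⟨by linarith, by linarith⟩
  refine ⟨hyx b ⟨h.lt, le_rfl⟩, ?_⟩
  -- At `t = a` the factor `x + σy` vanishes, so the derivative is positive only off this null set.
  have hne : ∀ᵐ t ∂(volume.restrict (Icc a b)), t ≠ a := ae_restrict_of_ae (by simp [ae_iff])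
  have key : ∀ σ : ℝ, σ = 1 ∨ σ = -1 → (γ a).x * (γ a).x - (γ a).y * (γ a).y - 4 * σ * (γ a).z <
      (γ b).x * (γ b).x - (γ b).y * (γ b).y - 4 * σ * (γ b).z := by
    intro σ hσ
    refine lt_of_hasDerivAt_pos
      (f := fun s => (γ s).x * (γ s).x - (γ s).y * (γ s).y - 4 * σ * (γ s).z)
      (f' := fun s => 2 * ((γ s).x + σ * (γ s).y) * ((u s).1 - σ * (u s).2)) h.lt
      (((h.ac_x.fun_mul h.ac_x).fun_sub (h.ac_y.fun_mul h.ac_y)).fun_sub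
        (h.ac_z.const_mul (4 * σ))) ?_ ?_
    · filter_upwards [h.hasDerivAt] with s hs
      obtain ⟨hx, hy, hz⟩ := hasDerivAt_components hs
      refine (((hx.mul hx).sub (hy.mul hy)).sub (hz.const_mul (4 * σ))).congr_deriv ?_
      rcases hσ with rfl | rfl <;> ring
    · filter_upwards [hu, hne, ae_restrict_mem measurableSet_Icc] with s hs hsa hm
      have k := abs_lt.mp (hyx s ⟨lt_of_le_of_ne hm.1 hsa.symm, hm.2⟩)
      have l := abs_lt.mp hs
      refine mul_pos (mul_pos two_pos ?_) ?_ <;>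
        rcases hσ with rfl | rfl <;> linarith
  have e1 := key 1 (Or.inl rfl)
  have e2 := key (-1) (Or.inr rfl)
  simp only [h1, one_x, one_y, one_z] at e1 e2
  have : |(γ b).z| < ((γ b).x ^ 2 - (γ b).y ^ 2) / 4 := abs_lt.mpr ⟨by linarith, by linarith⟩
  linarith

/-! ### Length estimates -/

theorem abs_fst_le_sqrt (v : ℝ × ℝ) : |v.1| ≤ Real.sqrt (v.1 ^ 2 + v.2 ^ 2) :=
  Real.abs_le_sqrt (by nlinarith [sq_nonneg v.2])

theorem abs_snd_le_sqrt (v : ℝ × ℝ) : |v.2| ≤ Real.sqrt (v.1 ^ 2 + v.2 ^ 2) :=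
  Real.abs_le_sqrt (by nlinarith [sq_nonneg v.1])

theorem sqrt_le_abs_add_abs (v : ℝ × ℝ) : Real.sqrt (v.1 ^ 2 + v.2 ^ 2) ≤ |v.1| + |v.2| := by
  refine Real.sqrt_le_iff.mpr ⟨by positivity, ?_⟩
  nlinarith [sq_abs v.1, sq_abs v.2, mul_nonneg (abs_nonneg v.1) (abs_nonneg v.2)]

theorem IsHorizontal.ofReal_abs_x_le (h : IsHorizontal γ u a b) (h1 : γ a = 1) :
    ENNReal.ofReal |(γ b).x| ≤ sRLength u a b := by
  have := ofReal_abs_sub_le_lintegral (f' := fun t => (u t).1) h.lt.le h.ac_x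
    (h.hasDerivAt.mono fun t ht => (hasDerivAt_components ht).1)
  simp only [h1, one_x, sub_zero] at this
  exact this.trans (lintegral_mono fun t => ENNReal.ofReal_le_ofReal (abs_fst_le_sqrt _))

theorem IsHorizontal.ofReal_abs_y_le (h : IsHorizontal γ u a b) (h1 : γ a = 1) :
    ENNReal.ofReal |(γ b).y| ≤ sRLength u a b := by
  have := ofReal_abs_sub_le_lintegral (f' := fun t => (u t).2) h.lt.le h.ac_y
    (h.hasDerivAt.mono fun t ht => (hasDerivAt_components ht).2.1)
  simp only [h1, one_y, sub_zero] at this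
  exact this.trans (lintegral_mono fun t => ENNReal.ofReal_le_ofReal (abs_snd_le_sqrt _))

theorem sRLength_mono {c d : ℝ} (hac : a ≤ c) (hdb : d ≤ b) : sRLength u c d ≤ sRLength u a b :=
  lintegral_mono_set (Icc_subset_Icc hac hdb)

/-- If `l` is the total length, then `|x|` and `|y|` stay below `l`, so `|ż| = |x u₂ - y u₁| / 2` is
at most `l` times the speed. Integration gives `|z| ≤ l²`. -/
theorem IsHorizontal.ofReal_sqrt_abs_z_le (h : IsHorizontal γ u a b) (h1 : γ a = 1) :
    ENNReal.ofReal (Real.sqrt |(γ b).z|) ≤ sRLength u a b := by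
  rcases eq_or_ne (sRLength u a b) ⊤ with htop | htop
  · simp [htop]
  set l : ℝ := (sRLength u a b).toReal with hl
  have hl' : ENNReal.ofReal l = sRLength u a b := ENNReal.ofReal_toReal htop
  have hl0 : 0 ≤ l := ENNReal.toReal_nonneg
  have hxy : ∀ t ∈ Icc a b, |(γ t).x| ≤ l ∧ |(γ t).y| ≤ l := by
    intro t ht
    rcases ht.1.eq_or_lt with rfl | hat
    · simp [h1, hl0]
    have ht' := h.mono le_rfl hat ht.2
    have hle : sRLength u a t ≤ sRLength u a b := sRLength_mono le_rfl ht.2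
    rw [← ENNReal.ofReal_le_ofReal_iff hl0, ← ENNReal.ofReal_le_ofReal_iff hl0, hl']
    exact ⟨(ht'.ofReal_abs_x_le h1).trans hle, (ht'.ofReal_abs_y_le h1).trans hle⟩
  have key := ofReal_abs_sub_le_lintegral h.lt.le h.ac_z
    (h.hasDerivAt.mono fun t ht => (hasDerivAt_components ht).2.2)
  simp only [h1, one_z, sub_zero] at key
  have key2 : ENNReal.ofReal |(γ b).z| ≤ ENNReal.ofReal (l * l) := by
    rw [ENNReal.ofReal_mul hl0]
    nth_rewrite 2 [hl']
    rw [sRLength, ← lintegral_const_mul' _ _ ENNReal.ofReal_ne_top]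
    refine key.trans (setLIntegral_mono' measurableSet_Icc fun t ht => ?_)
    rw [← ENNReal.ofReal_mul hl0]
    refine ENNReal.ofReal_le_ofReal ?_
    obtain ⟨hx, hy⟩ := hxy t ht
    set s := Real.sqrt ((u t).1 ^ 2 + (u t).2 ^ 2)
    have e1 : |(γ t).x * (u t).2| ≤ l * s := by
      rw [abs_mul]
      exact mul_le_mul hx (abs_snd_le_sqrt _) (abs_nonneg _) hl0
    have e2 : |(γ t).y * (u t).1| ≤ l * s := by
      rw [abs_mul]
      exact mul_le_mul hy (abs_fst_le_sqrt _) (abs_nonneg _) hl0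
    rw [abs_div, abs_two]
    linarith [abs_sub ((γ t).x * (u t).2) ((γ t).y * (u t).1)]
  rw [ENNReal.ofReal_le_ofReal_iff (mul_nonneg hl0 hl0)] at key2
  rw [← hl', ENNReal.ofReal_le_ofReal_iff hl0]
  exact Real.sqrt_le_iff.mpr ⟨hl0, by rwa [sq]⟩

/-- Left translation by `p⁻¹` keeps the control, hence the length, and moves the starting point to
the identity. -/
theorem le_edist_of_forall_curve {F : Heis → ℝ≥0∞}
    (hF : ∀ (γ : ℝ → Heis) (u : ℝ → ℝ × ℝ) (a b : ℝ), IsHorizontal γ u a b → γ a = 1 →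
      F (γ b) ≤ sRLength u a b) (p q : Heis) : F (p⁻¹ * q) ≤ edist p q := by
  refine le_sInf ?_
  rintro L ⟨γ, u, a, b, h, rfl, rfl, rfl⟩
  exact hF _ _ _ _ (h.mul_left (γ a)⁻¹) (by simp)

theorem ofReal_abs_x_le_edist (p q : Heis) : ENNReal.ofReal |(p⁻¹ * q).x| ≤ edist p q :=
  le_edist_of_forall_curve (F := fun r => ENNReal.ofReal |r.x|)
    (fun _ _ _ _ h h1 => h.ofReal_abs_x_le h1) p q

theorem ofReal_abs_y_le_edist (p q : Heis) : ENNReal.ofReal |(p⁻¹ * q).y| ≤ edist p q :=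
  le_edist_of_forall_curve (F := fun r => ENNReal.ofReal |r.y|)
    (fun _ _ _ _ h h1 => h.ofReal_abs_y_le h1) p q

theorem ofReal_sqrt_abs_z_le_edist (p q : Heis) :
    ENNReal.ofReal (Real.sqrt |(p⁻¹ * q).z|) ≤ edist p q :=
  le_edist_of_forall_curve (F := fun r => ENNReal.ofReal (Real.sqrt |r.z|))
    (fun _ _ _ _ h h1 => h.ofReal_sqrt_abs_z_le h1) p q

end Horizontal

/-! ### One-parameter subgroups -/

/-- Along a ray from the identity in the plane `z = 0`, `x u₂ - y u₁` vanishes, so the lift stays in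
that plane. -/
theorem isHorizontal_line (p : Heis) (v : ℝ × ℝ) :
    IsHorizontal (fun t => p * ⟨t * v.1, t * v.2, 0⟩) (fun _ => v) 0 1 := by
  refine IsHorizontal.mul_left (γ := fun t => ⟨t * v.1, t * v.2, 0⟩) ?_ p
  have hd : ∀ (c t : ℝ), HasDerivAt (fun s => s * c) c t := fun c t => by
    simpa using (hasDerivAt_id t).mul_const c
  have hac : ∀ c : ℝ, AbsolutelyContinuousOnInterval (fun s => s * c) 0 1 := fun c =>
    (LipschitzWith.lipschitzOnWith (lipschitzWith_of_nnnorm_deriv_le (C := ‖c‖₊)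
      (fun t => (hd c t).differentiableAt)
      (fun t => by rw [(hd c t).deriv]))).absolutelyContinuousOnInterval
  refine ⟨one_pos, ac_prodMk (hac _) (ac_prodMk (hac _) (ac_const _ _ _)), memLp_const v, ?_⟩
  refine Eventually.of_forall fun t => hasDerivAt_coords (hd _ _) (hd _ _) ?_
  refine (hasDerivAt_const t (0 : ℝ)).congr_deriv ?_
  simp only
  ring

theorem edist_mul_line_le (p : Heis) (v w : ℝ) :
    edist p (p * ⟨v, w, 0⟩) ≤ ENNReal.ofReal (|v| + |w|) := by
  have h := (isHorizontal_line p (v, w)).sRDist_le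
  simp only [zero_mul, one_mul] at h
  change sRDist (p * 1) _ ≤ _ at h
  rw [mul_one] at h
  refine h.trans ?_
  simp only [sRLength, lintegral_const, MeasurableSet.univ, Measure.restrict_apply, univ_inter,
    Real.volume_Icc, sub_zero, ENNReal.ofReal_one, mul_one]
  exact ENNReal.ofReal_le_ofReal (sqrt_le_abs_add_abs (v, w))

/-- The vertical part of `r` is a commutator of horizontal elements, so five horizontal segments
lead from `p` to `p * r`. -/
theorem edist_mul_le (p r : Heis) :
    edist p (p * r) ≤ ENNReal.ofReal (|r.x| + |r.y| + 4 * Real.sqrt |r.z|) := by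
  obtain ⟨σ, hσ, hσz⟩ : ∃ σ : ℝ, |σ| = Real.sqrt |r.z| ∧ Real.sqrt |r.z| * σ = r.z := by
    rcases le_total 0 r.z with h | h
    · exact ⟨Real.sqrt |r.z|, abs_of_nonneg (Real.sqrt_nonneg _), by
        rw [Real.mul_self_sqrt (abs_nonneg _), abs_of_nonneg h]⟩
    · exact ⟨-Real.sqrt |r.z|, by rw [abs_neg, abs_of_nonneg (Real.sqrt_nonneg _)], by
        rw [mul_neg, Real.mul_self_sqrt (abs_nonneg _), abs_of_nonpos h, neg_neg]⟩
  set s := Real.sqrt |r.z| with hs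
  have hs0 : |s| = s := abs_of_nonneg (Real.sqrt_nonneg _)
  -- The last four factors form the commutator `(0, 0, s σ)`. The choice `|σ| = s = √|z|`, with the
  -- sign of `z` carried by `σ`, makes it equal to `(0, 0, z)` at cost `4 s`.
  have e : p * r = p * ⟨r.x, r.y, 0⟩ * ⟨s, 0, 0⟩ * ⟨0, σ, 0⟩ * ⟨-s, 0, 0⟩ * ⟨0, -σ, 0⟩ := by
    ext <;> simp
    rw [← hσz]
    ring
  rw [e]
  refine (edist_triangle4 _ (p * ⟨r.x, r.y, 0⟩) (p * ⟨r.x, r.y, 0⟩ * ⟨s, 0, 0⟩) _).trans ?_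
  have k1 := edist_mul_line_le p r.x r.y
  have k2 := edist_mul_line_le (p * ⟨r.x, r.y, 0⟩) s 0
  have k3 := edist_mul_line_le (p * ⟨r.x, r.y, 0⟩ * ⟨s, 0, 0⟩) 0 σ
  have k4 := edist_mul_line_le (p * ⟨r.x, r.y, 0⟩ * ⟨s, 0, 0⟩ * ⟨0, σ, 0⟩) (-s) 0
  have k5 := edist_mul_line_le (p * ⟨r.x, r.y, 0⟩ * ⟨s, 0, 0⟩ * ⟨0, σ, 0⟩ * ⟨-s, 0, 0⟩) 0 (-σ)
  simp only [abs_neg, abs_zero, add_zero, zero_add, hs0, hσ] at k2 k3 k4 k5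
  have hs1 : 0 ≤ s := Real.sqrt_nonneg _
  calc _ ≤ ENNReal.ofReal (|r.x| + |r.y|) + ENNReal.ofReal s +
        (ENNReal.ofReal s + ENNReal.ofReal s + ENNReal.ofReal s) :=
        add_le_add (add_le_add k1 k2)
          ((edist_triangle4 _ _ _ _).trans (add_le_add (add_le_add k3 k4) k5))
    _ = _ := by
        rw [← ENNReal.ofReal_add (by positivity) hs1, ← ENNReal.ofReal_add hs1 hs1,
          ← ENNReal.ofReal_add (by positivity) hs1,
          ← ENNReal.ofReal_add (by positivity) (by positivity)]
        congr 1
        ring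

/-! ### The topology of the sub-Riemannian distance -/

theorem tendsto_of_ofReal_abs_le_edist {g : Heis → ℝ} {p : Heis}
    (h : ∀ q, ENNReal.ofReal |g q| ≤ edist p q) : Tendsto g (𝓝 p) (𝓝 0) := by
  rw [tendsto_iff_edist_tendsto_0]
  have h0 : Tendsto (fun q => edist q p) (𝓝 p) (𝓝 0) :=
    tendsto_iff_edist_tendsto_0.mp tendsto_id
  refine tendsto_of_tendsto_of_tendsto_of_le_of_le tendsto_const_nhds h0 (fun _ => zero_le) ?_
  intro q
  simp only [edist_comm q p]
  refine le_trans (le_of_eq ?_) (h q)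
  rw [edist_dist, Real.dist_eq, sub_zero]

theorem continuous_coords : Continuous coords := by
  rw [continuous_iff_continuousAt]
  intro p
  have hx := tendsto_of_ofReal_abs_le_edist (ofReal_abs_x_le_edist p)
  have hy := tendsto_of_ofReal_abs_le_edist (ofReal_abs_y_le_edist p)
  have hz : Tendsto (fun q => (p⁻¹ * q).z) (𝓝 p) (𝓝 0) := by
    have hs : Tendsto (fun q => Real.sqrt |(p⁻¹ * q).z|) (𝓝 p) (𝓝 0) :=
      tendsto_of_ofReal_abs_le_edist fun q => by
        rw [abs_of_nonneg (Real.sqrt_nonneg _)]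
        exact ofReal_sqrt_abs_z_le_edist p q
    refine (tendsto_zero_iff_abs_tendsto_zero _).mpr ?_
    have := hs.mul hs
    simpa only [Function.comp_def, Real.mul_self_sqrt (abs_nonneg _), mul_zero] using this
  -- Writing `q = p * (p⁻¹ * q)` turns the coordinates of `q` into polynomials in those of `p⁻¹ *
  -- q`, which tend to `0`.
  have e : coords = fun q => (p.x + (p⁻¹ * q).x, p.y + (p⁻¹ * q).y,
      p.z + (p⁻¹ * q).z + (p.x * (p⁻¹ * q).y - (p⁻¹ * q).x * p.y) / 2) := by
    funext q
    conv_lhs => rw [← mul_inv_cancel_left p q]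
    rfl
  rw [ContinuousAt, e]
  have lx : Tendsto (fun q => p.x + (p⁻¹ * q).x) (𝓝 p) (𝓝 (p.x + 0)) := hx.const_add _
  have ly : Tendsto (fun q => p.y + (p⁻¹ * q).y) (𝓝 p) (𝓝 (p.y + 0)) := hy.const_add _
  have lz : Tendsto (fun q => p.z + (p⁻¹ * q).z + (p.x * (p⁻¹ * q).y - (p⁻¹ * q).x * p.y) / 2)
      (𝓝 p) (𝓝 (p.z + 0 + (p.x * 0 - 0 * p.y) / 2)) :=
    (hz.const_add _).add (((hy.const_mul _).sub (hx.mul_const _)).div_const 2)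
  convert lx.prodMk_nhds (ly.prodMk_nhds lz) using 2
  simp

@[fun_prop]
theorem continuous_x : Continuous fun p : Heis => p.x := continuous_coords.fst

@[fun_prop]
theorem continuous_y : Continuous fun p : Heis => p.y := continuous_coords.snd.fst

@[fun_prop]
theorem continuous_z : Continuous fun p : Heis => p.z := continuous_coords.snd.snd

theorem continuous_mk : Continuous fun c : ℝ × ℝ × ℝ => (⟨c.1, c.2.1, c.2.2⟩ : Heis) := by
  rw [continuous_iff_continuousAt]
  intro c
  rw [ContinuousAt, tendsto_iff_edist_tendsto_0]
  set p : Heis := ⟨c.1, c.2.1, c.2.2⟩ with hp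
  -- This is the bound of `edist_mul_le` for `p⁻¹ * d` in coordinates: continuous in `d` and zero at
  -- `d = c`.
  let g : ℝ × ℝ × ℝ → ℝ := fun d => |-c.1 + d.1| + |-c.2.1 + d.2.1| +
    4 * Real.sqrt |-c.2.2 + d.2.2 + (-c.1 * d.2.1 - d.1 * -c.2.1) / 2|
  have hg : Continuous g := by fun_prop
  have hg0 : Tendsto (fun d => ENNReal.ofReal (g d)) (𝓝 c) (𝓝 0) := by
    have := (ENNReal.continuous_ofReal.comp hg).tendsto c
    have h0 : g c = 0 := by
      have : -c.2.2 + c.2.2 + (-c.1 * c.2.1 - c.1 * -c.2.1) / 2 = 0 := by ring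
      simp [g]
    simpa only [Function.comp_def, h0, ENNReal.ofReal_zero] using this
  refine tendsto_of_tendsto_of_tendsto_of_le_of_le tendsto_const_nhds hg0 (fun _ => zero_le) ?_
  intro d
  have := edist_mul_le p (p⁻¹ * ⟨d.1, d.2.1, d.2.2⟩)
  rw [mul_inv_cancel_left] at this
  simp only
  rw [edist_comm]
  exact this

/-- The global coordinates are a homeomorphism. -/
def coordsHomeomorph : Heis ≃ₜ ℝ × ℝ × ℝ where
  toFun := coords
  invFun c := ⟨c.1, c.2.1, c.2.2⟩
  left_inv _ := rfl
  right_inv _ := rfl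
  continuous_toFun := continuous_coords
  continuous_invFun := continuous_mk

/-! ### Explicit description of the causal relations -/

theorem isCausalVec_isFutureVec_of_abs_le {v : ℝ × ℝ} (h : |v.2| ≤ v.1) (h0 : 0 < v.1) :
    IsCausalVec v ∧ IsFutureVec v := by
  refine ⟨⟨?_, ?_⟩, ?_⟩
  · have := abs_le.mp h
    rw [lorentz_self]
    exact mul_nonpos_of_nonpos_of_nonneg (by linarith) (by linarith)
  · rintro rfl
    simp at h0
  · simpa [IsFutureVec, lorentz] using h0

theorem isTimelikeVec_isFutureVec_of_abs_lt {v : ℝ × ℝ} (h : |v.2| < v.1) :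
    IsTimelikeVec v ∧ IsFutureVec v := by
  refine ⟨?_, ?_⟩
  · have := abs_lt.mp h
    rw [IsTimelikeVec, lorentz_self]
    exact mul_neg_of_neg_of_pos (by linarith) (by linarith)
  · simpa [IsFutureVec, lorentz] using (abs_nonneg _).trans_lt h

theorem exists_two_lines (p : Heis) (v w : ℝ × ℝ) :
    ∃ (γ : ℝ → Heis) (u : ℝ → ℝ × ℝ) (a b : ℝ), IsHorizontal γ u a b ∧
      (∀ t, u t = v ∨ u t = w) ∧ γ a = p ∧ γ b = p * ⟨v.1, v.2, 0⟩ * ⟨w.1, w.2, 0⟩ := by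
  have h₁ := isHorizontal_line p v
  have h₂ := (isHorizontal_line (p * ⟨v.1, v.2, 0⟩) w).translate (-1)
  have e₁ : (0 : ℝ) - -1 = 1 := by norm_num
  have e₂ : (1 : ℝ) - -1 = 2 := by norm_num
  rw [e₁, e₂] at h₂
  refine ⟨_, _, 0, 2, h₁.concat h₂ ?_, fun t => ?_, ?_, ?_⟩
  · ext <;> simp
  · by_cases ht : t ≤ 1 <;> simp [ht]
  · ext <;> simp
  · rw [if_neg (by norm_num)]
    ext <;> simp <;> ring

/-- A point of the solid cone is a product of two points of the horizontal cone. -/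
theorem exists_factorization {r : Heis} (hxy : |r.y| ≤ r.x) (hz : 4 * |r.z| ≤ r.x ^ 2 - r.y ^ 2) :
    ∃ σ τ : ℝ, σ + τ = 1 ∧ 0 ≤ σ ∧ 0 ≤ τ ∧
      (τ - σ) * ((r.x + r.y) * (r.x - r.y)) = 4 * r.z ∧
      ((r.x + r.y) * (r.x - r.y) = 0 → σ = τ) ∧
      (4 * |r.z| < r.x ^ 2 - r.y ^ 2 → 0 < σ ∧ 0 < τ) := by
  obtain ⟨h1, h2⟩ := abs_le.mp hxy
  have hS : r.x ^ 2 - r.y ^ 2 = (r.x + r.y) * (r.x - r.y) := by ring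
  rw [hS] at hz ⊢
  set S := (r.x + r.y) * (r.x - r.y)
  have hS0 : 0 ≤ S := mul_nonneg (by linarith) (by linarith)
  -- On the boundary `S = 0` the height `z` is zero and any splitting solves the equation; equal
  -- halves keep both factors nonzero when `r ≠ 1`. Otherwise `σ + τ = 1` and `(τ - σ) S = 4z`
  -- determine `σ` and `τ`.
  rcases hS0.eq_or_lt with h | h
  · have hz0 : r.z = 0 := abs_nonpos_iff.mp (by linarith)
    refine ⟨1 / 2, 1 / 2, by norm_num, by norm_num, by norm_num, ?_, fun _ => rfl,
      fun _ => by norm_num⟩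
    rw [hz0]
    ring
  · obtain ⟨k1, k2⟩ := abs_le.mp (show |r.z| ≤ S / 4 by linarith)
    have k : 4 * r.z / S ≤ 1 ∧ -1 ≤ 4 * r.z / S :=
      ⟨by rw [div_le_iff₀ h]; linarith, by rw [le_div_iff₀ h]; linarith⟩
    refine ⟨(1 - 4 * r.z / S) / 2, (1 + 4 * r.z / S) / 2, by ring, by linarith, by linarith, ?_,
      fun h0 => absurd h0 h.ne', fun hlt => ?_⟩
    · field_simp
      ring
    · obtain ⟨l1, l2⟩ := abs_lt.mp (show |r.z| < S / 4 by linarith)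
      have l : 4 * r.z / S < 1 ∧ -1 < 4 * r.z / S :=
        ⟨by rw [div_lt_iff₀ h]; linarith, by rw [lt_div_iff₀ h]; linarith⟩
      exact ⟨by linarith, by linarith⟩

/-- In the null coordinates `A = x + y`, `B = x - y` of `r`, the two segments are `(σA, τB)` and
`(τA, σB)`. They add up to `(A, B)`, and their product has height `(τ² - σ²)AB / 4 = (τ - σ)AB / 4`.
-/
theorem exists_two_lines_to {p r : Heis} {σ τ : ℝ} (hστ : σ + τ = 1)
    (hz : (τ - σ) * ((r.x + r.y) * (r.x - r.y)) = 4 * r.z) :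
    ∃ (γ : ℝ → Heis) (u : ℝ → ℝ × ℝ) (a b : ℝ), IsHorizontal γ u a b ∧
      (∀ t, u t = ((σ * (r.x + r.y) + τ * (r.x - r.y)) / 2,
          (σ * (r.x + r.y) - τ * (r.x - r.y)) / 2) ∨
        u t = ((τ * (r.x + r.y) + σ * (r.x - r.y)) / 2,
          (τ * (r.x + r.y) - σ * (r.x - r.y)) / 2)) ∧ γ a = p ∧ γ b = p * r := by
  obtain ⟨γ, u, a, b, h, hu, ha, hb⟩ := exists_two_lines p
    ((σ * (r.x + r.y) + τ * (r.x - r.y)) / 2, (σ * (r.x + r.y) - τ * (r.x - r.y)) / 2)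
    ((τ * (r.x + r.y) + σ * (r.x - r.y)) / 2, (τ * (r.x + r.y) - σ * (r.x - r.y)) / 2)
  refine ⟨γ, u, a, b, h, hu, ha, ?_⟩
  rw [hb, mul_assoc]
  congr 1
  obtain rfl : τ = 1 - σ := by linarith
  ext <;> simp only [mul_x, mul_y, mul_z]
  · ring
  · ring
  · linear_combination hz / 4

theorem causalRel_iff (p q : Heis) : CausalRel p q ↔ |(p⁻¹ * q).y| ≤ (p⁻¹ * q).x ∧
    4 * |(p⁻¹ * q).z| ≤ (p⁻¹ * q).x ^ 2 - (p⁻¹ * q).y ^ 2 := by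
  constructor
  · rintro (rfl | ⟨γ, u, a, b, ⟨h, hu⟩, rfl, rfl⟩)
    · simp
    · exact (h.mul_left (γ a)⁻¹).cone_le (by simp)
        (hu.mono fun t ht => abs_le_of_causal ht.1 ht.2)
  · obtain ⟨r, rfl⟩ : ∃ r, q = p * r := ⟨p⁻¹ * q, by simp⟩
    rw [inv_mul_cancel_left]
    rintro ⟨hxy, hz⟩
    obtain ⟨σ, τ, hστ, hσ, hτ, hS, hS0, -⟩ := exists_factorization hxy hz
    obtain ⟨h1, h2⟩ := abs_le.mp hxy
    have hA : 0 ≤ r.x + r.y := by linarith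
    have hB : 0 ≤ r.x - r.y := by linarith
    have hx : 0 ≤ r.x := by linarith
    -- At `x = 0` the cone reduces to the identity, which the clause `p = q` covers.
    rcases hx.eq_or_lt with hx0 | hx0
    · left
      have hy0 : r.y = 0 := by linarith
      have hr : r = 1 := by
        ext
        · exact hx0.symm
        · exact hy0
        · simp only [← hx0, hy0] at hS
          simp only [one_z]
          linarith
      rw [hr, mul_one]
    · right
      -- A causal control must have `u₁ > 0`, so neither segment may degenerate.
      have hpos : 0 < σ * (r.x + r.y) + τ * (r.x - r.y) ∧
          0 < τ * (r.x + r.y) + σ * (r.x - r.y) := by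
        rcases eq_or_ne ((r.x + r.y) * (r.x - r.y)) 0 with h0 | h0
        · obtain rfl := hS0 h0
          obtain rfl : σ = 1 / 2 := by linarith
          constructor <;> linarith
        · have hA' := lt_of_le_of_ne hA (left_ne_zero_of_mul h0).symm
          have hB' := lt_of_le_of_ne hB (right_ne_zero_of_mul h0).symm
          rcases hσ.eq_or_lt with h | h
          · have hτ1 : τ = 1 := by linarith
            rw [← h, hτ1]
            constructor <;> linarith
          · constructor <;> nlinarith [mul_pos h hA', mul_pos h hB', mul_nonneg hτ hA,
              mul_nonneg hτ hB]
      obtain ⟨γ, u, a, b, h, hu, ha, hb⟩ := exists_two_lines_to (p := p) hστ hS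
      refine ⟨γ, u, a, b, ⟨h, Eventually.of_forall fun t => ?_⟩, ha, hb⟩
      have m1 := mul_nonneg hσ hA
      have m2 := mul_nonneg hσ hB
      have m3 := mul_nonneg hτ hA
      have m4 := mul_nonneg hτ hB
      rcases hu t with e | e <;> rw [e] <;>
        exact isCausalVec_isFutureVec_of_abs_le
          (abs_le.mpr ⟨by simp only; linarith, by simp only; linarith⟩)
          (by simp only; linarith [hpos.1, hpos.2])

theorem timelikeRel_iff (p q : Heis) : TimelikeRel p q ↔ |(p⁻¹ * q).y| < (p⁻¹ * q).x ∧
    4 * |(p⁻¹ * q).z| < (p⁻¹ * q).x ^ 2 - (p⁻¹ * q).y ^ 2 := by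
  constructor
  · rintro ⟨γ, u, a, b, ⟨h, hu⟩, rfl, rfl⟩
    exact (h.mul_left (γ a)⁻¹).cone_lt (by simp) (hu.mono fun t ht => abs_lt_of_timelike ht.1 ht.2)
  · obtain ⟨r, rfl⟩ : ∃ r, q = p * r := ⟨p⁻¹ * q, by simp⟩
    rw [inv_mul_cancel_left]
    rintro ⟨hxy, hz⟩
    obtain ⟨σ, τ, hστ, -, -, hS, -, hpos⟩ := exists_factorization hxy.le hz.le
    -- Strictness in `z` makes both weights positive, hence all null coordinates of both segments
    -- positive: both are timelike.
    obtain ⟨hσ, hτ⟩ := hpos hz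
    obtain ⟨h1, h2⟩ := abs_lt.mp hxy
    have hA : 0 < r.x + r.y := by linarith
    have hB : 0 < r.x - r.y := by linarith
    obtain ⟨γ, u, a, b, h, hu, ha, hb⟩ := exists_two_lines_to (p := p) hστ hS
    refine ⟨γ, u, a, b, ⟨h, Eventually.of_forall fun t => ?_⟩, ha, hb⟩
    have m1 := mul_pos hσ hA
    have m2 := mul_pos hσ hB
    have m3 := mul_pos hτ hA
    have m4 := mul_pos hτ hB
    rcases hu t with e | e <;> rw [e] <;>
      exact isTimelikeVec_isFutureVec_of_abs_lt
        (abs_lt.mpr ⟨by simp only; linarith, by simp only; linarith⟩)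

/-! ### Strong causality and causal closedness -/

theorem isOpen_timelikeRel : IsOpen {pq : Heis × Heis | TimelikeRel pq.1 pq.2} := by
  simp only [timelikeRel_iff, mul_x, mul_y, mul_z, inv_x, inv_y, inv_z]
  refine IsOpen.and (isOpen_lt ?_ ?_) (isOpen_lt ?_ ?_) <;> fun_prop

theorem isClosed_causalRel : IsClosed {pq : Heis × Heis | CausalRel pq.1 pq.2} := by
  simp only [causalRel_iff, mul_x, mul_y, mul_z, inv_x, inv_y, inv_z]
  refine IsClosed.and (isClosed_le ?_ ?_) (isClosed_le ?_ ?_) <;> fun_prop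

theorem mem_chronologicalFuture_singleton {p q : Heis} :
    q ∈ chronologicalFuture {p} ↔ TimelikeRel p q := by
  simp [chronologicalFuture]

theorem mem_chronologicalPast_singleton {p q : Heis} :
    p ∈ chronologicalPast {q} ↔ TimelikeRel p q := by
  simp [chronologicalPast]

theorem isOpen_chronologicalDiamond (p q : Heis) :
    IsOpen (chronologicalFuture {p} ∩ chronologicalPast {q}) := by
  have e : chronologicalFuture {p} ∩ chronologicalPast {q} =
      {s | TimelikeRel p s} ∩ {s | TimelikeRel s q} := by
    ext s
    exact and_congr mem_chronologicalFuture_singleton mem_chronologicalPast_singleton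
  rw [e]
  exact (isOpen_timelikeRel.preimage (Continuous.prodMk_right p)).inter
    (isOpen_timelikeRel.preimage (Continuous.prodMk_left q))

theorem self_mem_chronologicalDiamond (q : Heis) {ε : ℝ} (hε : 0 < ε) :
    q ∈ chronologicalFuture {q * ⟨-ε, 0, 0⟩} ∩ chronologicalPast {q * ⟨ε, 0, 0⟩} := by
  refine ⟨mem_chronologicalFuture_singleton.mpr ((timelikeRel_iff _ _).mpr ?_),
    mem_chronologicalPast_singleton.mpr ((timelikeRel_iff _ _).mpr ?_)⟩
  · rw [mul_inv_rev, inv_mul_cancel_right]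
    simp [hε]
  · rw [inv_mul_cancel_left]
    simp [hε]

/-- With `s = q * r`, the two cones give `|r.x| + |r.y| < ε` and `|r.z| ≤ (2ε)²`; the constant is
`10 = 1 + 1 + 4 · 2`. -/
theorem edist_le_of_mem_chronologicalDiamond {q s : Heis} {ε : ℝ} (hε : 0 < ε)
    (hs : s ∈ chronologicalFuture {q * ⟨-ε, 0, 0⟩} ∩ chronologicalPast {q * ⟨ε, 0, 0⟩}) :
    edist q s ≤ ENNReal.ofReal (10 * ε) := by
  have h1 := (timelikeRel_iff _ _).mp (mem_chronologicalFuture_singleton.mp hs.1)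
  have h2 := (timelikeRel_iff _ _).mp (mem_chronologicalPast_singleton.mp hs.2)
  obtain ⟨r, rfl⟩ : ∃ r, s = q * r := ⟨q⁻¹ * s, by simp⟩
  rw [mul_inv_rev, mul_assoc, inv_mul_cancel_left] at h1
  rw [mul_inv_rev, mul_assoc, inv_mul_cancel_left] at h2
  simp only [mul_x, mul_y, mul_z, inv_x, inv_y, inv_z, neg_neg, neg_zero, zero_add, mul_zero,
    sub_zero, add_zero] at h1 h2
  obtain ⟨a1, a2⟩ := abs_lt.mp h1.1
  obtain ⟨a3, a4⟩ := abs_lt.mp h2.1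
  have hx : |r.x| ≤ ε := abs_le.mpr ⟨by linarith, by linarith⟩
  have hy : |r.y| ≤ ε := abs_le.mpr ⟨by linarith, by linarith⟩
  have hz : |r.z| ≤ (2 * ε) ^ 2 := by
    -- Left multiplication by `(ε, 0, 0)` shifts the height by `ε r.y / 2`, itself of order `ε²`.
    have k := abs_le.mp (show |r.z + ε * r.y / 2| ≤ ε ^ 2 by
      nlinarith [h1.2, (abs_le.mp hx).1, (abs_le.mp hx).2, sq_nonneg r.y])
    obtain ⟨b1, b2⟩ := abs_le.mp hy
    exact abs_le.mpr ⟨by nlinarith, by nlinarith⟩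
  have hz' : Real.sqrt |r.z| ≤ 2 * ε := Real.sqrt_le_iff.mpr ⟨by linarith, hz⟩
  exact (edist_mul_le q r).trans (ENNReal.ofReal_le_ofReal (by linarith))

theorem stronglyCausal : StronglyCausal := by
  refine le_antisymm ?_ (le_generateFrom ?_)
  · intro U hU
    -- An open set is the union of the diamonds it contains, so no finite intersections of subbasic
    -- sets are needed.
    have e : U = ⋃₀ {S | (∃ p q : Heis, S = chronologicalFuture {p} ∩ chronologicalPast {q}) ∧
        S ⊆ U} := by
      refine Subset.antisymm (fun q hq => ?_) (sUnion_subset fun S hS => hS.2)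
      obtain ⟨δ, hδ, hb⟩ := EMetric.isOpen_iff.mp hU q hq
      obtain ⟨ε, hε0, hε⟩ := ENNReal.lt_iff_exists_nnreal_btwn.mp hδ
      have hε0' : (0 : ℝ) < ε / 10 := div_pos (by exact_mod_cast hε0) (by norm_num)
      refine ⟨_, ⟨⟨_, _, rfl⟩, fun s hs => hb ?_⟩, self_mem_chronologicalDiamond q hε0'⟩
      rw [Metric.mem_eball, edist_comm]
      refine (edist_le_of_mem_chronologicalDiamond hε0' hs).trans_lt ?_
      rwa [mul_div_cancel₀ _ (by norm_num), ENNReal.ofReal_coe_nnreal]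
    rw [e]
    exact TopologicalSpace.GenerateOpen.sUnion _ fun S hS =>
      TopologicalSpace.GenerateOpen.basic S hS.1
  · rintro _ ⟨p, q, rfl⟩
    exact isOpen_chronologicalDiamond p q

/-! ### Lengths of causal curves -/

section Length

variable {γ : ℝ → Heis} {u : ℝ → ℝ × ℝ} {a b : ℝ}

/-- The speed is at most `|u₁| + |u₂| ≤ 2σu₁`, whose integral is `2σ` times the increment of `x`.
The sign `σ` treats both time orientations at once. -/
theorem sRLength_le_of_sign (h : IsHorizontal γ u a b) (σ : ℝ) (hσ : |σ| = 1)
    (hu : ∀ᵐ t ∂(volume.restrict (Icc a b)), |(u t).2| ≤ σ * (u t).1) :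
    sRLength u a b ≤ ENNReal.ofReal (2 * |(γ b).x - (γ a).x|) := by
  have key := lintegral_eq_ofReal_sub (f := fun t => 2 * σ * (γ t).x)
    (f' := fun t => 2 * σ * (u t).1) h.lt.le (h.ac_x.const_mul _)
    (h.hasDerivAt.mono fun t ht => (hasDerivAt_components ht).1.const_mul _)
    (hu.mono fun t ht => by linarith [(abs_nonneg (u t).2).trans ht])
  calc sRLength u a b ≤ ∫⁻ t in Icc a b, ENNReal.ofReal (2 * σ * (u t).1) := by
        refine lintegral_mono_ae ?_
        filter_upwards [hu] with t ht
        refine ENNReal.ofReal_le_ofReal ((sqrt_le_abs_add_abs (u t)).trans ?_)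
        have h0 := (abs_nonneg (u t).2).trans ht
        have : |(u t).1| = σ * (u t).1 := by rw [← abs_of_nonneg h0, abs_mul, hσ, one_mul]
        linarith
    _ ≤ _ := by
        rw [key]
        refine ENNReal.ofReal_le_ofReal ?_
        have e : 2 * σ * (γ b).x - 2 * σ * (γ a).x = 2 * (σ * ((γ b).x - (γ a).x)) := by ring
        rw [e]
        have := le_abs_self (σ * ((γ b).x - (γ a).x))
        rw [abs_mul, hσ, one_mul] at this
        linarith

theorem IsCausalCurve.isHorizontal (h : IsCausalCurve γ u a b) : IsHorizontal γ u a b :=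
  h.elim And.left And.left

/-- The length of a causal curve is bounded by the variation of the time coordinate. -/
theorem IsCausalCurve.sRLength_le (h : IsCausalCurve γ u a b) :
    sRLength u a b ≤ ENNReal.ofReal (2 * |(γ b).x - (γ a).x|) := by
  rcases h with ⟨h, hu⟩ | ⟨h, hu⟩
  · refine sRLength_le_of_sign h 1 (by simp) (hu.mono fun t ht => ?_)
    rw [one_mul]
    exact abs_le_of_causal ht.1 ht.2
  · refine sRLength_le_of_sign h (-1) (by simp) (hu.mono fun t ht => ?_)
    have h0 : (u t).1 < 0 := by simpa [IsPastVec, lorentz] using ht.2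
    have h1 := ht.1.1
    simp only [lorentz] at h1
    exact abs_le_of_sq_le_sq (by nlinarith) (by linarith)

theorem IsHorizontal.eVariationOn_le (h : IsHorizontal γ u a b) :
    eVariationOn γ (Icc a b) ≤ sRLength u a b := by
  refine iSup_le ?_
  rintro ⟨n, s, hs, hm⟩
  let F : ℝ → ℝ≥0∞ := fun t => ENNReal.ofReal (Real.sqrt ((u t).1 ^ 2 + (u t).2 ^ 2))
  -- Half-open intervals make consecutive pieces disjoint, and `c = d` is allowed because partition
  -- points may repeat.
  have step : ∀ c d : ℝ, a ≤ c → c ≤ d → d ≤ b → edist (γ d) (γ c) ≤ ∫⁻ t in Ioc c d, F t := by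
    intro c d hac hcd hdb
    rcases hcd.eq_or_lt with rfl | hlt
    · simp
    · rw [edist_comm, setLIntegral_congr Ioc_ae_eq_Icc]
      exact (h.mono hac hlt hdb).sRDist_le
  have key : ∀ m : ℕ, ∑ i ∈ Finset.range m, edist (γ (s (i + 1))) (γ (s i)) ≤
      ∫⁻ t in Ioc (s 0) (s m), F t := by
    intro m
    induction m with
    | zero => simp
    | succ m ih =>
      rw [Finset.sum_range_succ, ← Ioc_union_Ioc_eq_Ioc (hs (Nat.zero_le m)) (hs m.le_succ),
        lintegral_union measurableSet_Ioc (Ioc_disjoint_Ioc_of_le le_rfl)]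
      exact add_le_add ih (step _ _ (hm m).1 (hs m.le_succ) (hm (m + 1)).2)
  exact (key n).trans (lintegral_mono_set
    (Ioc_subset_Icc_self.trans (Icc_subset_Icc (hm 0).1 (hm n).2)))

theorem compatibleWithDist : CompatibleWithDist := by
  intro q
  -- A slab in `x` suffices: `x` varies by at most `2` in it, and the length is at most twice that.
  refine ⟨{s | |s.x - q.x| < 1}, (isOpen_lt (by fun_prop) (by fun_prop)).mem_nhds (by simp), 4,
    by norm_num, fun γ u a b h hm => ?_⟩
  refine (h.isHorizontal.eVariationOn_le.trans h.sRLength_le).trans (ENNReal.ofReal_le_ofReal ?_)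
  have ha : |(γ a).x - q.x| < 1 := hm ⟨le_rfl, h.isHorizontal.lt.le⟩
  have hb : |(γ b).x - q.x| < 1 := hm ⟨h.isHorizontal.lt.le, le_rfl⟩
  obtain ⟨a1, a2⟩ := abs_lt.mp ha
  obtain ⟨b1, b2⟩ := abs_lt.mp hb
  have : |(γ b).x - (γ a).x| ≤ 2 := abs_le.mpr ⟨by linarith, by linarith⟩
  linarith

/-! ### Compactness of causal diamonds -/

theorem exists_coord_bound {K : Set Heis} (hK : IsCompact K) :
    ∃ M : ℝ, 0 ≤ M ∧ ∀ p ∈ K, |p.x| ≤ M ∧ |p.y| ≤ M ∧ |p.z| ≤ M := by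
  obtain ⟨M, hM⟩ := (hK.image continuous_coords).isBounded.exists_norm_le
  refine ⟨max M 0, le_max_right _ _, fun p hp => ?_⟩
  have := (hM _ (mem_image_of_mem _ hp)).trans (le_max_left M 0)
  simpa only [coords, Prod.norm_def, Real.norm_eq_abs, max_le_iff] using this

theorem isCompact_coord_box (M : ℝ) :
    IsCompact {p : Heis | |p.x| ≤ M ∧ |p.y| ≤ M ∧ |p.z| ≤ M} := by
  have := coordsHomeomorph.isCompact_preimage.mpr (isCompact_closedBall (0 : ℝ × ℝ × ℝ) M)
  convert this using 1
  ext p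
  rw [mem_preimage, mem_closedBall_zero_iff]
  change _ ↔ ‖coords p‖ ≤ M
  simp [coords, Prod.norm_def]

theorem nonTotallyImprisoning : NonTotallyImprisoning := by
  intro K hK
  obtain ⟨M, hM0, hM⟩ := exists_coord_bound hK
  -- The bound is `2 · 2M`; the extra `1` keeps the constant positive when `M = 0`.
  refine ⟨4 * M + 1, by linarith, fun γ u a b h hm => ?_⟩
  refine h.sRLength_le.trans (ENNReal.ofReal_le_ofReal ?_)
  obtain ⟨a1, a2⟩ := abs_le.mp (hM _ (hm ⟨le_rfl, h.isHorizontal.lt.le⟩)).1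
  obtain ⟨b1, b2⟩ := abs_le.mp (hM _ (hm ⟨h.isHorizontal.lt.le, le_rfl⟩)).1
  have : |(γ b).x - (γ a).x| ≤ 2 * M := abs_le.mpr ⟨by linarith, by linarith⟩
  linarith

/-- Since `x` increases along `≤`, `r.x` is squeezed between `p.x` and `q.x`; the cone at `p` then
bounds `r.y` by `M + 2M`, and `r.z` by `M + M² + (3M² + M²) / 2`. -/
theorem coord_bound_of_between {p r q : Heis} {M : ℝ} (hM : 0 ≤ M)
    (hp : |p.x| ≤ M ∧ |p.y| ≤ M ∧ |p.z| ≤ M) (hq : |q.x| ≤ M) (hpr : CausalRel p r)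
    (hrq : CausalRel r q) :
    |r.x| ≤ 3 * M + 3 * M ^ 2 ∧ |r.y| ≤ 3 * M + 3 * M ^ 2 ∧ |r.z| ≤ 3 * M + 3 * M ^ 2 := by
  have h1 := (causalRel_iff _ _).mp hpr
  have h2 := ((causalRel_iff _ _).mp hrq).1
  simp only [mul_x, mul_y, mul_z, inv_x, inv_y, inv_z] at h1 h2
  obtain ⟨hpx, hpy, hpz⟩ := hp
  obtain ⟨px1, px2⟩ := abs_le.mp hpx
  obtain ⟨py1, py2⟩ := abs_le.mp hpy
  obtain ⟨pz1, pz2⟩ := abs_le.mp hpz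
  obtain ⟨qx1, qx2⟩ := abs_le.mp hq
  obtain ⟨c1, c2⟩ := abs_le.mp h1.1
  have hrx := (abs_nonneg _).trans h2
  have hrx' := (abs_nonneg _).trans h1.1
  have hx : |r.x| ≤ M := abs_le.mpr ⟨by linarith, by linarith⟩
  have hy : |r.y| ≤ 3 * M := abs_le.mpr ⟨by linarith, by linarith⟩
  have hM2 : 0 ≤ M ^ 2 := sq_nonneg M
  refine ⟨by linarith, by linarith, ?_⟩
  have m1 : |p.x * r.y| ≤ M * (3 * M) := by
    rw [abs_mul]
    exact mul_le_mul hpx hy (abs_nonneg _) hM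
  have m2 : |r.x * p.y| ≤ M * M := by
    rw [abs_mul]
    exact mul_le_mul hx hpy (abs_nonneg _) hM
  have m3 : (-p.x + r.x) ^ 2 ≤ (2 * M) ^ 2 := pow_le_pow_left₀ hrx' (by linarith) 2
  have m4 := abs_le.mp (show |-p.z + r.z + (-p.x * r.y - r.x * -p.y) / 2| ≤ M ^ 2 by
    nlinarith [h1.2, sq_nonneg (-p.y + r.y)])
  obtain ⟨d1, d2⟩ := abs_le.mp m1
  obtain ⟨e1, e2⟩ := abs_le.mp m2
  exact abs_le.mpr ⟨by nlinarith [m4.1], by nlinarith [m4.2]⟩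

theorem isCompact_causalDiamond {K₁ K₂ : Set Heis} (h₁ : IsCompact K₁) (h₂ : IsCompact K₂) :
    IsCompact (causalFuture K₁ ∩ causalPast K₂) := by
  obtain ⟨M₁, hM₁, hK₁⟩ := exists_coord_bound h₁
  obtain ⟨M₂, hM₂, hK₂⟩ := exists_coord_bound h₂
  set M := M₁ + M₂
  set B : Set Heis := {r | |r.x| ≤ 3 * M + 3 * M ^ 2 ∧ |r.y| ≤ 3 * M + 3 * M ^ 2 ∧
    |r.z| ≤ 3 * M + 3 * M ^ 2}
  -- The triples `(p, r, q)` with `p ≤ r ≤ q` form a closed subset of a compact product, and the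
  -- diamond is its projection to the middle factor.
  have hS : IsCompact ((K₁ ×ˢ B ×ˢ K₂) ∩ ({w : Heis × Heis × Heis | CausalRel w.1 w.2.1} ∩
      {w | CausalRel w.2.1 w.2.2})) :=
    (h₁.prod ((isCompact_coord_box _).prod h₂)).inter_right
      ((isClosed_causalRel.preimage (continuous_fst.prodMk continuous_snd.fst)).inter
        (isClosed_causalRel.preimage continuous_snd))
  convert hS.image continuous_snd.fst using 1
  ext r
  constructor
  · rintro ⟨⟨p, hp, hpr⟩, q, hq, hrq⟩
    obtain ⟨hp1, hp2, hp3⟩ := hK₁ p hp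
    have hq1 := (hK₂ q hq).1
    exact ⟨(p, r, q), ⟨⟨hp, coord_bound_of_between (add_nonneg hM₁ hM₂)
      ⟨by linarith, by linarith, by linarith⟩ (by linarith) hpr hrq, hq⟩, hpr, hrq⟩, rfl⟩
  · rintro ⟨⟨p, r, q⟩, ⟨⟨hp, -, hq⟩, hpr, hrq⟩, rfl⟩
    exact ⟨⟨p, hp, hpr⟩, q, hq, hrq⟩

end Length

end Heis

theorem mainTheorem6 :
    Heis.StronglyCausal ∧ Heis.CausallyClosed ∧ Heis.CompatibleWithDist ∧
      Heis.NonTotallyImprisoning ∧ Heis.GloballyHyperbolic ∧ Heis.KGloballyHyperbolic :=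
  ⟨Heis.stronglyCausal, Heis.isClosed_causalRel, Heis.compatibleWithDist,
    Heis.nonTotallyImprisoning,
    ⟨Heis.nonTotallyImprisoning, fun _ _ =>
      Heis.isCompact_causalDiamond isCompact_singleton isCompact_singleton⟩,
    ⟨Heis.nonTotallyImprisoning, fun _ _ h₁ h₂ => Heis.isCompact_causalDiamond h₁ h₂⟩⟩
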